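/- Fix a signature $\mathcal A$, i.e. a set of names $a$, each with an arity $\mathrm{ar}(a)\in\mathbb N$. Positive designs $P$ and negative designs $N$ are the possibly infinite terms (up to renaming of bound variables) generated coinductively by $$P ::= \Omega \mid \maltese \mid N_0\,|\,\overline a\langle N_1,\dots,N_{\mathrm{ar}(a)}\rangle, \qquad N ::= x \mid \textstyle\sum_{a} a(x_1,\dots,x_{\mathrm{ar}(a)}).P_a ,$$ where the sum ranges over all names $a$ and $x_1,\dots,x_{\mathrm{ar}(a)}$ are bound in $P_a$. A cut is a design $(\sum_a a(\vec x).P_a)\,|\,\overline b\langle \vec N\rangle$; it reduces to $P_b[\vec N/\vec x]$. A design is cut-free if none of its subdesigns is a cut, and linear if in each of its subdesigns $N_0|\overline a\langle N_1,\dots,N_n\rangle$ the sets of free variables of $N_0,\dots,N_n$ are pairwise disjoint. The normal form $[\![P]\!]$ of a positive design is defined corecursively: it is $\maltese$ if $P$ reduces in finitely many steps to $\maltese$; it is $x|\overline a\langle[\![N_1]\!],\dots,[\![N_n]\!]\rangle$ if $P$ reduces in finitely many steps to $x|\overline a\langle N_1,\dots,N_n\rangle$; and it is $\Omega$ otherwise.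 For negative designs, $[\![x]\!]=x$ and $[\![\sum_a a(\vec x).P_a]\!]=\sum_a a(\vec x).[\![P_a]\!]$. Let $\mathcal P$ be the set of linear cut-free positive designs with at most the variable $x_0$ free, and $\mathcal N$ the set of linear cut-free negative designs without free variables. For $p\in\mathcal P$ and $n\in\mathcal N$ put $p\perp n$ iff $[\![p[n/x_0]]\!]=\maltese$. Let $\mathcal O$ be one of $\mathcal P,\mathcal N$ and $\overline{\mathcal O}$ the other. For $X\subseteq\mathcal O$ let $X^\perp\subseteq\overline{\mathcal O}$ be the set of terms orthogonal to all elements of $X$; $X$ is closed if $X=X^{\perp\perp}$. For $a,b\in\mathcal O$ write $a\lhd_{\mathcal O} b$ (specialization) if $\{a\}^\perp\subseteq\{b\}^\perp$. For $X\subseteq\mathcal O$ and $b\in\mathcal O$ write $X\mathrel{\unlhd}_{\mathcal O} b$ (semantical consequence) if $\bigcap_{a\in X}\{a\}^\perp\subseteq\{b\}^\perp$. An entailment system is a set $T$ with a relation $\Vdash$ between subsets and elements of $T$ such that (Axiom) $u\in U$ implies $U\Vdash u$, and (Cut) if $U\Vdash v$ for all $v\in V$ and $V\Vdash u$, then $U\Vdash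 u$. Let $\mathcal F$ be any set of linear cut-free negative designs with at most $x_0$ free; its elements are called functionals. Theorem. (1) $(\mathcal P,\unlhd_{\mathcal P})$ and $(\mathcal N,\unlhd_{\mathcal N})$ are entailment systems. (2) Each $g\in\mathcal F$ induces maps $\widehat g:\mathcal P\to\mathcal P$, $\widehat g(p)=[\![p[g/x_0]]\!]$, and $\widehat g:\mathcal N\to\mathcal N$, $\widehat g(n)=[\![g[n/x_0]]\!]$ (so the values do lie in $\mathcal P$ and $\mathcal N$, respectively), and each $g\in\mathcal F$ - is regular: $\widehat g(p)\perp n$ if and only if $p\perp\widehat g(n)$, for all $p\in\mathcal P$ and $n\in\mathcal N$; - is continuous in $\mathcal P$ and in $\mathcal N$: for $\mathcal O\in\{\mathcal P,\mathcal N\}$ and every $X\subseteq\mathcal O$, the set $\{a\in\mathcal O:\widehat g(a)\in X^{\perp\perp}\}$ is closed; - preserves semantical consequence in $\mathcal P$ and in $\mathcal N$: $X\mathrel{\unlhd}_{\mathcal O}b$ implies $\{\widehat g(a):a\in X\}\mathrel{\unlhd}_{\mathcal O}\widehat g(b)$; - preserves specialization in $\mathcal P$ and in $\mathcal N$: $a\lhd_{\mathcal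 O}b$ implies $\widehat g(a)\lhd_{\mathcal O}\widehat g(b)$. -/

import Mathlib

universe u v w

/-! ### Triads, semantical consequence, functionals -/

/-- A triad: positive terms, negative terms and an orthogonality relation between them.  The two
kinds of terms are two separate types, so they are disjoint. -/
structure Triad where
  Pos : Type u
  Neg : Type v
  orth : Pos → Neg → Prop

namespace Triad

/-- The triad with the roles of positive and negative terms exchanged.  All notions below are
written for the positive terms of a triad; for the negative terms of `T` they are taken in
`T.dual`. -/
def dual (T : Triad.{u, v}) : Triad.{v, u} where
  Pos := T.Neg
  Neg := T.Pos
  orth n p := T.orth p n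

/-- The orthogonal set `X^⊥`. -/
def perp (T : Triad.{u, v}) (X : Set T.Pos) : Set T.Neg := {b | ∀ a ∈ X, T.orth a b}

/-- The biorthogonal set `X^⊥⊥`. -/
def biperp (T : Triad.{u, v}) (X : Set T.Pos) : Set T.Pos := T.dual.perp (T.perp X)

/-- Closed sets. -/
def IsClosedSet (T : Triad.{u, v}) (X : Set T.Pos) : Prop := X = T.biperp X

/-- The specialization relation `a ⊲ b`. -/
def Spec (T : Triad.{u, v}) (a b : T.Pos) : Prop := T.perp {a} ⊆ T.perp {b}

/-- The relation of semantical consequence: `b` is a semantical consequence of `X`. -/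
def Conseq (T : Triad.{u, v}) (X : Set T.Pos) (b : T.Pos) : Prop :=
  (⋂ a ∈ X, T.perp {a}) ⊆ T.perp {b}

end Triad

/-- `(T, ent)` is an entailment system. -/
structure IsEntailmentSystem {T : Type u} (ent : Set T → T → Prop) : Prop where
  ax : ∀ (t : T) (U : Set T), t ∈ U → ent U t
  cut : ∀ (t : T) (U V : Set T), (∀ s ∈ V, ent U s) → ent V t → ent U t

/-- A collection of functionals for the triad `T`, with set of functionals `Fn`.  A polarity
preserving function from the disjoint union of `T.Pos` and `T.Neg` to itself is the same as a pair
of functions, one on `T.Pos` and one on `T.Neg`. -/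
structure FunctionalCollection (T : Triad.{u, v}) (Fn : Type w) where
  interpPos : Fn → T.Pos → T.Pos
  interpNeg : Fn → T.Neg → T.Neg

namespace FunctionalCollection

variable {T : Triad.{u, v}} {Fn : Type w}

/-- The same collection of functionals, for the dual triad. -/
def dual (H : FunctionalCollection T Fn) : FunctionalCollection T.dual Fn where
  interpPos := H.interpNeg
  interpNeg := H.interpPos

/-- `f` is continuous in the set of positive terms: pre-images of closed sets are closed. -/
def Continuous (H : FunctionalCollection T Fn) (f : Fn) : Prop :=
  ∀ X : Set T.Pos, T.IsClosedSet (H.interpPos f ⁻¹' T.biperp X)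

/-- `f` preserves the relation of specialization on positive terms. -/
def PreservesSpec (H : FunctionalCollection T Fn) (f : Fn) : Prop :=
  ∀ a b : T.Pos, T.Spec a b → T.Spec (H.interpPos f a) (H.interpPos f b)

/-- `f` preserves the relation of semantical consequence on positive terms. -/
def PreservesConseq (H : FunctionalCollection T Fn) (f : Fn) : Prop :=
  ∀ (X : Set T.Pos) (b : T.Pos), T.Conseq X b → T.Conseq (H.interpPos f '' X) (H.interpPos f b)

/-- `f` is regular. -/
def Regular (H : FunctionalCollection T Fn) (f : Fn) : Prop :=
  ∀ (p : T.Pos) (n : T.Neg), T.orth (H.interpPos f p) n ↔ T.orth p (H.interpNeg f n)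

end FunctionalCollection

/-! ### Designs -/

namespace Ludics

/-- A signature: a set of names, each with an arity. -/
structure Signature where
  Name : Type u
  arity : Name → ℕ

variable {S : Signature.{u}}

/-- One layer of a negative design: a variable, or a formal sum `∑ a(x₁,…,xₙ).P_a` over all names
`a`.  Variables are de Bruijn indices, so that designs are taken up to renaming of bound
variables: in the component of `a`, the indices `0, …, arity a - 1` stand for the bound
`x₁, …, xₙ`, and the index `arity a + k` stands for the outer variable `k`. -/
inductive NegF (S : Signature.{u}) (X : Type u) : Type u
  | var (k : ℕ) : NegF S X
  | sum (Q : S.Name → X) : NegF S X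

/-- One layer of a positive design: divergence `Ω`, the daimon `✠`, or an action
`N₀ | ā⟨N₁,…,Nₙ⟩` with `n = arity a`. -/
inductive PosF (S : Signature.{u}) (X : Type u) : Type u
  | omega : PosF S X
  | daimon : PosF S X
  | act (a : S.Name) (head : NegF S X) (args : Fin (S.arity a) → NegF S X) : PosF S X

/-- Functorial action. -/
def NegF.map {X Y : Type u} (f : X → Y) : NegF S X → NegF S Y
  | .var k => .var k
  | .sum Q => .sum fun a => f (Q a)

/-- Functorial action. -/
def PosF.map {X Y : Type u} (f : X → Y) : PosF S X → PosF S Y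
  | .omega => .omega
  | .daimon => .daimon
  | .act a h N => .act a (h.map f) fun i => (N i).map f

/-- The immediate negative components `N₀` (index `none`) and `Nᵢ` (index `some i`) of an action. -/
def comp {X : Type u} {n : ℕ} (h : NegF S X) (N : Fin n → NegF S X) : Option (Fin n) → NegF S X
  | none => h
  | some i => N i

/-- `PosF S` as a polynomial functor: an action is a name together with, for each component, the
information whether it is a variable (and which) or a sum. -/
def posPFunctor (S : Signature.{u}) : PFunctor.{u, u} where
  A := PosF S PUnit.{u + 1}
  B
    | .omega => PEmpty
    | .daimon => PEmpty
    | .act _ h N => {o // ∃ Q, comp h N o = NegF.sum Q} × S.Name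

/-- Refill one component from its shape. -/
def NegF.fill {X : Type u} :
    (s : NegF S PUnit.{u + 1}) → ((∃ Q, s = NegF.sum Q) → S.Name → X) → NegF S X
  | .var k, _ => .var k
  | .sum Q, f => .sum fun a => f ⟨Q, rfl⟩ a

/-- Content of one component. -/
def NegF.content {X : Type u} : (s : NegF S X) →
    (∃ Q, s.map (fun _ => PUnit.unit.{u + 1}) = NegF.sum Q) → S.Name → X
  | .var _, h => absurd h (by rintro ⟨Q, hQ⟩; cases hQ)
  | .sum Q, _ => Q

theorem NegF.fill_content {X : Type u} (s : NegF S X) :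
    NegF.fill (s.map fun _ => PUnit.unit) s.content = s := by
  cases s <;> rfl

theorem NegF.fill_map {X Y : Type u} (g : X → Y) (s : NegF S PUnit.{u + 1})
    (f : (∃ Q, s = NegF.sum Q) → S.Name → X) :
    NegF.fill s (fun h a => g (f h a)) = (NegF.fill s f).map g := by
  cases s <;> rfl

instance : QPF (PosF S) where
  map := PosF.map
  P := posPFunctor S
  abs
    | ⟨.omega, _⟩ => .omega
    | ⟨.daimon, _⟩ => .daimon
    | ⟨.act a h N, f⟩ =>
      .act a (h.fill fun e b => f (⟨none, e⟩, b)) fun i => (N i).fill fun e b => f (⟨some i, e⟩, b)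
  repr
    | .omega => ⟨.omega, fun e => nomatch e⟩
    | .daimon => ⟨.daimon, fun e => nomatch e⟩
    | .act a h N => ⟨.act a (h.map fun _ => PUnit.unit) fun i => (N i).map fun _ => PUnit.unit,
        fun c => match c with
          | (⟨none, e⟩, b) => h.content e b
          | (⟨some i, e⟩, b) => (N i).content e b⟩
  abs_repr x := by
    cases x with
    | omega => rfl
    | daimon => rfl
    | act a h N =>
      exact congrArg₂ (PosF.act a) (NegF.fill_content h) (funext fun i => NegF.fill_content (N i))
  abs_map g p := by
    rcases p with ⟨_ | _ | ⟨a, h, N⟩, f⟩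
    · rfl
    · rfl
    · exact congrArg₂ (PosF.act a) (NegF.fill_map g h _) (funext fun i => NegF.fill_map g (N i) _)

/-- Positive designs: the final coalgebra of `PosF`, that is, the possibly infinite trees generated
by the grammar `P ::= Ω | ✠ | N₀ | ā⟨N₁,…,Nₙ⟩`, `N ::= x | ∑ a(x₁,…,xₙ).P_a`. -/
def Pos (S : Signature.{u}) : Type u := QPF.Cofix (PosF S)

/-- Negative designs. -/
abbrev Neg (S : Signature.{u}) : Type u := NegF S (Pos S)

/-- The outermost layer of a positive design. -/
def Pos.dest (P : Pos S) : PosF S (Pos S) := QPF.Cofix.dest P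

/-- Corecursive construction of positive designs. -/
def Pos.corec {X : Type u} (g : X → PosF S X) (x : X) : Pos S := QPF.Cofix.corec g x

theorem Pos.dest_corec {X : Type u} (g : X → PosF S X) (x : X) :
    (Pos.corec g x).dest = (g x).map (Pos.corec g) := QPF.Cofix.dest_corec g x

/-! ### Renaming and substitution -/

/-- A renaming, pushed under `m` binders. -/
def liftRen (m : ℕ) (ρ : ℕ → ℕ) (k : ℕ) : ℕ := if k < m then k else ρ (k - m) + m

/-- One layer of renaming in a negative component. -/
def renNeg (ρ : ℕ → ℕ) : Neg S → NegF S ((ℕ → ℕ) × Pos S)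
  | .var k => .var (ρ k)
  | .sum Q => .sum fun a => (liftRen (S.arity a) ρ, Q a)

/-- One layer of renaming. -/
def renStep (x : (ℕ → ℕ) × Pos S) : PosF S ((ℕ → ℕ) × Pos S) :=
  match x.2.dest with
  | .omega => .omega
  | .daimon => .daimon
  | .act a h N => .act a (renNeg x.1 h) fun i => renNeg x.1 (N i)

/-- Renaming of free variables in a positive design. -/
def Pos.rename (ρ : ℕ → ℕ) (P : Pos S) : Pos S := Pos.corec renStep (ρ, P)

/-- Renaming of free variables in a negative design. -/
def Neg.rename (ρ : ℕ → ℕ) (N : Neg S) : Neg S :=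
  NegF.map (fun x => Pos.rename x.1 x.2) (renNeg ρ N)

/-- A substitution, pushed under `m` binders. -/
def liftSubst (m : ℕ) (σ : ℕ → Neg S) (k : ℕ) : Neg S :=
  if k < m then .var k else Neg.rename (· + m) (σ (k - m))

/-- One layer of substitution in a negative component; `Sum.inl` marks the parts of substituted
designs, which are copied unchanged. -/
def substNeg (σ : ℕ → Neg S) : Neg S → NegF S (Pos S ⊕ ((ℕ → Neg S) × Pos S))
  | .var k => NegF.map Sum.inl (σ k)
  | .sum Q => .sum fun a => Sum.inr (liftSubst (S.arity a) σ, Q a)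

/-- One layer of substitution. -/
def substStep : Pos S ⊕ ((ℕ → Neg S) × Pos S) → PosF S (Pos S ⊕ ((ℕ → Neg S) × Pos S))
  | .inl P => P.dest.map Sum.inl
  | .inr (σ, P) =>
    match P.dest with
    | .omega => .omega
    | .daimon => .daimon
    | .act a h N => .act a (substNeg σ h) fun i => substNeg σ (N i)

/-- Simultaneous capture-avoiding substitution of `σ k` for each free variable `k` of a positive
design. -/
def Pos.subst (σ : ℕ → Neg S) (P : Pos S) : Pos S := Pos.corec substStep (Sum.inr (σ, P))

/-- Simultaneous capture-avoiding substitution in a negative design. -/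
def Neg.subst (σ : ℕ → Neg S) : Neg S → Neg S
  | .var k => σ k
  | .sum Q => .sum fun a => (Q a).subst (liftSubst (S.arity a) σ)

/-- The substitution `[N/x₀]`; the variable `x₀` is the index `0`. -/
def single (N : Neg S) (k : ℕ) : Neg S := if k = 0 then N else .var k

/-- The substitution `[N₁/x₁,…,Nₙ/xₙ]` of the arguments of an action for the variables bound in a
component of a formal sum, which leaves the scope of this binder. -/
def bindArgs {n : ℕ} (N : Fin n → Neg S) (k : ℕ) : Neg S :=
  if h : k < n then N ⟨k, h⟩ else .var (k - n)

/-! ### Normalization -/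

/-- A cut: an action `N₀ | ā⟨N₁,…,Nₙ⟩` whose head `N₀` is a formal sum. -/
def Pos.IsCut (P : Pos S) : Prop := ∃ a Q N, P.dest = .act a (.sum Q) N

/-- Reduction `(∑ a(x₁,…,xₙ).P_a) | ā⟨N₁,…,Nₙ⟩ ⟶ P_a[N₁/x₁,…,Nₙ/xₙ]`. -/
inductive Red : Pos S → Pos S → Prop
  | beta {P : Pos S} {a : S.Name} {Q : S.Name → Pos S} {N : Fin (S.arity a) → Neg S}
      (h : P.dest = .act a (.sum Q) N) : Red P ((Q a).subst (bindArgs N))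

/-- `P ⇓ R`: `P` reduces in finitely many steps to `R`, which is neither a cut nor `Ω`. -/
def Evaluates (P R : Pos S) : Prop :=
  Relation.ReflTransGen Red P R ∧ ¬ R.IsCut ∧ R.dest ≠ .omega

open Classical in
/-- One layer of the normal form: that of the design `P` evaluates to, and `Ω` if `P` diverges.
Reduction is deterministic, so the design chosen here is the only one. -/
noncomputable def nfStep (P : Pos S) : PosF S (Pos S) :=
  if h : ∃ R, Evaluates P R then h.choose.dest else .omega

/-- The normal form function on positive designs: `⟦P⟧ = ✠` if `P ⇓ ✠`,
`⟦P⟧ = x | ā⟨⟦N₁⟧,…,⟦Nₙ⟧⟩` if `P ⇓ x | ā⟨N₁,…,Nₙ⟩`, and `⟦P⟧ = Ω` if `P` diverges. -/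
noncomputable def Pos.nf (P : Pos S) : Pos S := Pos.corec nfStep P

/-- The normal form function on negative designs: `⟦x⟧ = x`, `⟦∑ a(x⃗).P_a⟧ = ∑ a(x⃗).⟦P_a⟧`. -/
noncomputable def Neg.nf (N : Neg S) : Neg S := NegF.map Pos.nf N

/-! ### Linear and cut-free designs, free variables -/

/-- `Pos.Free k P`: the variable `k` occurs free in `P`. -/
inductive Pos.Free : ℕ → Pos S → Prop
  | var {k : ℕ} {P : Pos S} {a : S.Name} {h : Neg S} {N : Fin (S.arity a) → Neg S}
      (o : Option (Fin (S.arity a))) :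
      P.dest = .act a h N → comp h N o = .var k → Pos.Free k P
  | sum {k : ℕ} {P : Pos S} {a : S.Name} {h : Neg S} {N : Fin (S.arity a) → Neg S}
      {Q : S.Name → Pos S} (o : Option (Fin (S.arity a))) (b : S.Name) :
      P.dest = .act a h N → comp h N o = .sum Q → Pos.Free (k + S.arity b) (Q b) → Pos.Free k P

/-- `Neg.Free k N`: the variable `k` occurs free in `N`. -/
def Neg.Free (k : ℕ) : Neg S → Prop
  | .var j => j = k
  | .sum Q => ∃ b, Pos.Free (k + S.arity b) (Q b)

/-- `Subdesign R P`: `R` is a positive subdesign of `P` (possibly `P` itself). -/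
inductive Subdesign : Pos S → Pos S → Prop
  | refl (P : Pos S) : Subdesign P P
  | step {R P : Pos S} {a : S.Name} {h : Neg S} {N : Fin (S.arity a) → Neg S}
      {Q : S.Name → Pos S} (o : Option (Fin (S.arity a))) (b : S.Name) :
      P.dest = .act a h N → comp h N o = .sum Q → Subdesign R (Q b) → Subdesign R P

/-- Linearity: in each subdesign `N₀ | ā⟨N₁,…,Nₙ⟩` the sets of free variables of `N₀, …, Nₙ` are
pairwise disjoint. -/
def Pos.Linear (P : Pos S) : Prop :=
  ∀ R, Subdesign R P → ∀ a h N, R.dest = .act a h N →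
    ∀ i j, i ≠ j → ∀ k, ¬ (Neg.Free k (comp h N i) ∧ Neg.Free k (comp h N j))

/-- Linearity of negative designs. -/
def Neg.Linear : Neg S → Prop
  | .var _ => True
  | .sum Q => ∀ b, (Q b).Linear

/-- A design is cut-free if none of its subdesigns is a cut. -/
def Pos.CutFree (P : Pos S) : Prop := ∀ R, Subdesign R P → ¬ R.IsCut

/-- Cut-freeness of negative designs. -/
def Neg.CutFree : Neg S → Prop
  | .var _ => True
  | .sum Q => ∀ b, (Q b).CutFree

/-! ### The triad of ludics -/

/-- Linear, cut-free positive designs with at most `x₀` as free variable. -/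
def AtomicPos (S : Signature.{u}) : Type u :=
  {P : Pos S // P.Linear ∧ P.CutFree ∧ ∀ k, P.Free k → k = 0}

/-- Linear, cut-free negative designs without free variables. -/
def AtomicNeg (S : Signature.{u}) : Type u :=
  {N : Neg S // N.Linear ∧ N.CutFree ∧ ∀ k, ¬ N.Free k}

/-- Functionals of ludics: linear, cut-free negative designs with at most `x₀` as free variable. -/
def Functional (S : Signature.{u}) : Type u :=
  {N : Neg S // N.Linear ∧ N.CutFree ∧ ∀ k, N.Free k → k = 0}

/-- The triad of ludics: `p` is orthogonal to `n` if the normal form of `p[n/x₀]` is the daimon. -/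
def ludicsTriad (S : Signature.{u}) : Triad.{u, u} where
  Pos := AtomicPos S
  Neg := AtomicNeg S
  orth p n := (p.1.subst (single n.1)).nf.dest = .daimon

end Ludics

/-! ### Semantical consequence in an arbitrary triad -/

namespace Triad

variable (T : Triad.{u, v})

/-! Part (1) holds in any triad, as does the passage in part (2) from regularity to the other
properties. Regularity says that the two actions of a functional are adjoint for orthogonality, so a
test of `ĝ(a)` against `n` becomes a test of `a` against `ĝ(n)`. It is self-dual, hence each
consequence is proved once and reused in the dual triad.

Regularity itself rests on two facts: `p[g/x₀][n/x₀] = p[g[n/x₀]/x₀]`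
(`Ludics.subst_single_subst_single`), and normalizing a design before substituting, or the design
substituted, does not affect whether the result reaches the daimon. The second does not require
normal forms to agree. The relation `NfRel`, generated by identity, normalization and substitution,
is shown to preserve and reflect convergence to the daimon: related designs expose matching outer
layers (`NfRel.simulates`), and matching cuts contract to related designs (`NfRel.red`).

The actions land in the right sets because reduction creates no free variables and preserves
linearity, and because a normal form never has a cut at any node. -/

theorem conseq_iff (X : Set T.Pos) (b : T.Pos) :
    T.Conseq X b ↔ ∀ n, (∀ a ∈ X, T.orth a n) → T.orth b n := by
  simp [Conseq, perp, Set.subset_def]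

theorem spec_iff (a b : T.Pos) : T.Spec a b ↔ ∀ n, T.orth a n → T.orth b n := by
  simp [Spec, perp, Set.subset_def]

theorem isEntailmentSystem_conseq : IsEntailmentSystem T.Conseq where
  ax t U h := (T.conseq_iff U t).2 fun _ hn => hn t h
  cut t U V hV ht := (T.conseq_iff U t).2 fun n hn =>
    (T.conseq_iff V t).1 ht n fun s hs => (T.conseq_iff U s).1 (hV s hs) n hn

end Triad

/-! ### Consequences of regularity in an arbitrary triad -/

namespace FunctionalCollection

variable {T : Triad.{u, v}} {Fn : Type w} {H : FunctionalCollection T Fn} {f : Fn}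

theorem Regular.dual (h : H.Regular f) : H.dual.Regular f := fun n p => (h p n).symm

/-- For `n` in `X^⊥`, regularity puts `ĝ(n)` in the orthogonal of the pre-image of `X^⊥⊥`. A point
of the biorthogonal of the pre-image is therefore orthogonal to `ĝ(n)`, and regularity moves `ĝ`
back. -/
theorem Regular.continuous (h : H.Regular f) : H.Continuous f := by
  intro X
  refine Set.Subset.antisymm (fun a ha b hb => hb a ha) fun a ha n hn => ?_
  refine (h a n).2 (ha (H.interpNeg f n) fun c hc => ?_)
  exact (h c n).1 (hc n hn)

theorem Regular.preservesConseq (h : H.Regular f) : H.PreservesConseq f := by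
  intro X b hb
  rw [Triad.conseq_iff] at hb ⊢
  intro n hn
  refine (h b n).2 (hb _ fun a ha => ?_)
  exact (h a n).1 (hn _ ⟨a, ha, rfl⟩)

theorem Regular.preservesSpec (h : H.Regular f) : H.PreservesSpec f := by
  intro a b hab
  rw [Triad.spec_iff] at hab ⊢
  exact fun n hn => (h b n).2 (hab _ ((h a n).1 hn))

end FunctionalCollection

namespace Ludics

open Relation

variable {S : Signature.{u}}

/-! ### Bisimulation -/

/-- Relation lifting for one layer of a negative design. -/
inductive NegF.Rel {X Y : Type u} (r : X → Y → Prop) : NegF S X → NegF S Y → Prop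
  | var (k : ℕ) : NegF.Rel r (.var k) (.var k)
  | sum {Q : S.Name → X} {Q' : S.Name → Y} (h : ∀ a, r (Q a) (Q' a)) :
      NegF.Rel r (.sum Q) (.sum Q')

/-- Relation lifting for one layer of a positive design. -/
inductive PosF.Rel {X Y : Type u} (r : X → Y → Prop) : PosF S X → PosF S Y → Prop
  | omega : PosF.Rel r .omega .omega
  | daimon : PosF.Rel r .daimon .daimon
  | act {a : S.Name} {h : NegF S X} {h' : NegF S Y} {N : Fin (S.arity a) → NegF S X}
      {N' : Fin (S.arity a) → NegF S Y} (hh : h.Rel r h') (hN : ∀ i, (N i).Rel r (N' i)) :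
      PosF.Rel r (.act a h N) (.act a h' N')

theorem NegF.Rel.refl {X : Type u} {r : X → X → Prop} (hr : ∀ x, r x x) (x : NegF S X) :
    x.Rel r x := by
  cases x with
  | var k => exact .var k
  | sum Q => exact .sum fun a => hr (Q a)

theorem PosF.Rel.refl {X : Type u} {r : X → X → Prop} (hr : ∀ x, r x x) (x : PosF S X) :
    x.Rel r x := by
  cases x with
  | omega => exact .omega
  | daimon => exact .daimon
  | act a h N => exact .act (.refl hr h) fun i => .refl hr (N i)

theorem NegF.Rel.map_quot_eq {X : Type u} {r : X → X → Prop} {x y : NegF S X} (h : x.Rel r y) :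
    x.map (Quot.mk r) = y.map (Quot.mk r) := by
  cases h with
  | var k => rfl
  | sum h => exact congrArg NegF.sum (funext fun a => Quot.sound (h a))

theorem PosF.Rel.map_quot_eq {X : Type u} {r : X → X → Prop} {x y : PosF S X} (h : x.Rel r y) :
    x.map (Quot.mk r) = y.map (Quot.mk r) := by
  cases h with
  | omega => rfl
  | daimon => rfl
  | act hh hN => exact congrArg₂ (PosF.act _) hh.map_quot_eq (funext fun i => (hN i).map_quot_eq)

/-- The coinduction principle of `QPF.Cofix` compares layers after quotienting by `r`; lifted
relatedness of layers gives this through `Quot.sound`. -/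
theorem Pos.eq_of_bisim (r : Pos S → Pos S → Prop)
    (hr : ∀ P P', r P P' → PosF.Rel r P.dest P'.dest) {P P' : Pos S} (h : r P P') : P = P' :=
  QPF.Cofix.bisim_rel r (fun x y hxy => (hr x y hxy).map_quot_eq) P P' h

/-- Apply a function to all immediate negative components. -/
def PosF.mapNeg {X Y : Type u} (f : NegF S X → NegF S Y) : PosF S X → PosF S Y
  | .omega => .omega
  | .daimon => .daimon
  | .act a h N => .act a (f h) fun i => f (N i)

theorem PosF.map_eq_mapNeg {X Y : Type u} (f : X → Y) (x : PosF S X) :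
    x.map f = x.mapNeg (NegF.map f) := by
  cases x <;> rfl

theorem PosF.mapNeg_mapNeg {X Y Z : Type u} (f : NegF S X → NegF S Y) (g : NegF S Y → NegF S Z)
    (x : PosF S X) : (x.mapNeg f).mapNeg g = x.mapNeg fun y => g (f y) := by
  cases x <;> rfl

theorem PosF.mapNeg_eq_act {X Y : Type u} {f : NegF S X → NegF S Y} {x : PosF S X} {a : S.Name}
    {h : NegF S Y} {N : Fin (S.arity a) → NegF S Y} (e : x.mapNeg f = .act a h N) :
    ∃ h' N', x = .act a h' N' ∧ h = f h' ∧ N = fun i => f (N' i) := by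
  cases x with
  | omega => cases e
  | daimon => cases e
  | act b h' N' => cases e; exact ⟨h', N', rfl, rfl, rfl⟩

theorem comp_map {X Y : Type u} {n : ℕ} (f : NegF S X → NegF S Y) (h : NegF S X)
    (N : Fin n → NegF S X) (o : Option (Fin n)) :
    comp (f h) (fun i => f (N i)) o = f (comp h N o) := by
  cases o <;> rfl

/-- Two families of functions on positive designs, each acting componentwise on the outermost layer,
are equal as soon as their actions on components agree up to these families. -/
theorem Pos.family_eq {ι : Type*} {F G : ι → Pos S → Pos S} {f g : ι → Neg S → Neg S}
    (hF : ∀ i P, (F i P).dest = P.dest.mapNeg (f i))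
    (hG : ∀ i P, (G i P).dest = P.dest.mapNeg (g i))
    (hfg : ∀ i N, NegF.Rel (fun X Y => X = Y ∨ ∃ j P, X = F j P ∧ Y = G j P) (f i N) (g i N))
    (i : ι) (P : Pos S) : F i P = G i P := by
  refine Pos.eq_of_bisim (fun X Y => X = Y ∨ ∃ j P, X = F j P ∧ Y = G j P) ?_
    (Or.inr ⟨i, P, rfl, rfl⟩)
  rintro _ _ (rfl | ⟨j, P, rfl, rfl⟩)
  · exact .refl (fun _ => .inl rfl) _
  · rw [hF, hG]
    cases P.dest with
    | omega => exact .omega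
    | daimon => exact .daimon
    | act a h N => exact .act (hfg j h) fun k => hfg j (N k)

/-! ### Renaming and substitution -/

theorem Pos.dest_rename (ρ : ℕ → ℕ) (P : Pos S) :
    (P.rename ρ).dest = P.dest.mapNeg (Neg.rename ρ) := by
  rw [Pos.rename, Pos.dest_corec, renStep]
  cases P.dest <;> rfl

/-- States marked `Sum.inl` only unfold their design, so corecursion copies it; this is what lets
`Pos.dest_subst` forget the auxiliary state space. -/
theorem Pos.corec_substStep_inl (P : Pos S) : Pos.corec substStep (.inl P) = P := by
  refine Pos.eq_of_bisim (fun X Y => X = Pos.corec substStep (.inl Y)) ?_ rfl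
  rintro _ Y rfl
  rw [Pos.dest_corec, substStep]
  have key (N : Neg S) : NegF.Rel (fun X Y => X = Pos.corec substStep (.inl Y))
      ((N.map Sum.inl).map (Pos.corec substStep)) N := by
    cases N with
    | var k => exact .var k
    | sum Q => exact .sum fun a => rfl
  cases Y.dest with
  | omega => exact .omega
  | daimon => exact .daimon
  | act a h N => exact .act (key h) fun i => key (N i)

theorem map_corec_substNeg (σ : ℕ → Neg S) (N : Neg S) :
    (substNeg σ N).map (Pos.corec substStep) = N.subst σ := by
  cases N with
  | sum Q => rfl
  | var k =>
    change ((σ k).map Sum.inl).map (Pos.corec substStep) = σ k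
    cases σ k with
    | var j => rfl
    | sum Q => exact congrArg NegF.sum (funext fun a => Pos.corec_substStep_inl (Q a))

theorem Pos.dest_subst (σ : ℕ → Neg S) (P : Pos S) :
    (P.subst σ).dest = P.dest.mapNeg (Neg.subst σ) := by
  rw [Pos.subst, Pos.dest_corec, substStep]
  cases P.dest with
  | omega => rfl
  | daimon => rfl
  | act a h N =>
    exact congrArg₂ (PosF.act a) (map_corec_substNeg σ h)
      (funext fun i => map_corec_substNeg σ (N i))

theorem liftRen_liftRen (m : ℕ) (ρ ρ' : ℕ → ℕ) (k : ℕ) :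
    liftRen m ρ' (liftRen m ρ k) = liftRen m (fun j => ρ' (ρ j)) k := by
  unfold liftRen
  split_ifs <;> first | rfl | omega | simp

theorem Pos.rename_rename (ρ ρ' : ℕ → ℕ) (P : Pos S) :
    (P.rename ρ).rename ρ' = P.rename fun k => ρ' (ρ k) := by
  -- The family ranges over all pairs of renamings, because passing under a binder replaces both by
  -- their lifts.
  refine Pos.family_eq (F := fun i : (ℕ → ℕ) × (ℕ → ℕ) => fun P => (P.rename i.1).rename i.2)
    (G := fun i P => P.rename fun k => i.2 (i.1 k))
    (f := fun i N => Neg.rename i.2 (Neg.rename i.1 N))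
    (g := fun i => Neg.rename fun k => i.2 (i.1 k)) ?_ ?_ ?_ (ρ, ρ') P
  · intro i P
    simp only [Pos.dest_rename, PosF.mapNeg_mapNeg]
  · intro i P
    rw [Pos.dest_rename]
  · rintro ⟨ρ, ρ'⟩ (k | Q)
    · exact .var _
    · refine .sum fun a => .inr ⟨(liftRen (S.arity a) ρ, liftRen (S.arity a) ρ'), Q a, rfl, ?_⟩
      exact congrArg (Pos.rename · (Q a)) (funext fun k => (liftRen_liftRen _ ρ ρ' k).symm)

theorem Neg.rename_rename (ρ ρ' : ℕ → ℕ) (N : Neg S) :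
    Neg.rename ρ' (Neg.rename ρ N) = Neg.rename (fun k => ρ' (ρ k)) N := by
  cases N with
  | var k => rfl
  | sum Q =>
    refine congrArg NegF.sum (funext fun a => (Pos.rename_rename _ _ (Q a)).trans ?_)
    exact congrArg (Pos.rename · (Q a)) (funext fun k => liftRen_liftRen _ ρ ρ' k)

theorem liftSubst_liftRen (m : ℕ) (ρ : ℕ → ℕ) (τ : ℕ → Neg S) (k : ℕ) :
    liftSubst m τ (liftRen m ρ k) = liftSubst m (fun j => τ (ρ j)) k := by
  unfold liftSubst liftRen
  split_ifs <;> first | rfl | omega | simp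

theorem Pos.subst_rename (ρ : ℕ → ℕ) (τ : ℕ → Neg S) (P : Pos S) :
    (P.rename ρ).subst τ = P.subst fun k => τ (ρ k) := by
  refine Pos.family_eq (F := fun i : (ℕ → ℕ) × (ℕ → Neg S) => fun P => (P.rename i.1).subst i.2)
    (G := fun i P => P.subst fun k => i.2 (i.1 k))
    (f := fun i N => Neg.subst i.2 (Neg.rename i.1 N))
    (g := fun i => Neg.subst fun k => i.2 (i.1 k)) ?_ ?_ ?_ (ρ, τ) P
  · intro i P
    simp only [Pos.dest_rename, Pos.dest_subst, PosF.mapNeg_mapNeg]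
  · intro i P
    rw [Pos.dest_subst]
  · rintro ⟨ρ, τ⟩ (k | Q)
    · exact .refl (fun _ => .inl rfl) _
    · refine .sum fun a => .inr ⟨(liftRen (S.arity a) ρ, liftSubst (S.arity a) τ), Q a, rfl, ?_⟩
      exact congrArg (Pos.subst · (Q a)) (funext fun k => (liftSubst_liftRen _ ρ τ k).symm)

theorem Neg.subst_rename (ρ : ℕ → ℕ) (τ : ℕ → Neg S) (N : Neg S) :
    Neg.subst τ (Neg.rename ρ N) = Neg.subst (fun k => τ (ρ k)) N := by
  cases N with
  | var k => rfl
  | sum Q =>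
    refine congrArg NegF.sum (funext fun a => (Pos.subst_rename _ _ (Q a)).trans ?_)
    exact congrArg (Pos.subst · (Q a)) (funext fun k => liftSubst_liftRen _ ρ τ k)

theorem rename_liftSubst (m : ℕ) (τ : ℕ → Neg S) (ρ : ℕ → ℕ) (k : ℕ) :
    Neg.rename (liftRen m ρ) (liftSubst m τ k) = liftSubst m (fun j => Neg.rename ρ (τ j)) k := by
  unfold liftSubst
  split_ifs with h
  · exact congrArg NegF.var (if_pos h)
  · simp only [Neg.rename_rename]
    exact congrArg (Neg.rename · _) (funext fun j => by simp [liftRen])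

theorem Pos.rename_subst (τ : ℕ → Neg S) (ρ : ℕ → ℕ) (P : Pos S) :
    (P.subst τ).rename ρ = P.subst fun k => Neg.rename ρ (τ k) := by
  refine Pos.family_eq (F := fun i : (ℕ → Neg S) × (ℕ → ℕ) => fun P => (P.subst i.1).rename i.2)
    (G := fun i P => P.subst fun k => Neg.rename i.2 (i.1 k))
    (f := fun i N => Neg.rename i.2 (Neg.subst i.1 N))
    (g := fun i => Neg.subst fun k => Neg.rename i.2 (i.1 k)) ?_ ?_ ?_ (τ, ρ) P
  · intro i P
    simp only [Pos.dest_rename, Pos.dest_subst, PosF.mapNeg_mapNeg]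
  · intro i P
    rw [Pos.dest_subst]
  · rintro ⟨τ, ρ⟩ (k | Q)
    · exact .refl (fun _ => .inl rfl) _
    · refine .sum fun a => .inr ⟨(liftSubst (S.arity a) τ, liftRen (S.arity a) ρ), Q a, rfl, ?_⟩
      exact congrArg (Pos.subst · (Q a)) (funext fun k => (rename_liftSubst _ τ ρ k).symm)

theorem Neg.rename_subst (τ : ℕ → Neg S) (ρ : ℕ → ℕ) (N : Neg S) :
    Neg.rename ρ (Neg.subst τ N) = Neg.subst (fun k => Neg.rename ρ (τ k)) N := by
  cases N with
  | var k => rfl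
  | sum Q =>
    refine congrArg NegF.sum (funext fun a => (Pos.rename_subst _ _ (Q a)).trans ?_)
    exact congrArg (Pos.subst · (Q a)) (funext fun k => rename_liftSubst _ τ ρ k)

/-- Off the bound indices this compares a shift followed by a lifted substitution with a
substitution followed by a shift, which is why both mixed laws for renaming and substitution are
needed before `Pos.subst_subst`. -/
theorem subst_liftSubst (m : ℕ) (σ τ : ℕ → Neg S) (k : ℕ) :
    Neg.subst (liftSubst m τ) (liftSubst m σ k) = liftSubst m (fun j => Neg.subst τ (σ j)) k := by
  unfold liftSubst
  split_ifs with h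
  · exact if_pos h
  · simp only [Neg.rename_subst, Neg.subst_rename]
    exact congrArg (Neg.subst · _) (funext fun j => by simp)

theorem Pos.subst_subst (σ τ : ℕ → Neg S) (P : Pos S) :
    (P.subst σ).subst τ = P.subst fun k => Neg.subst τ (σ k) := by
  refine Pos.family_eq (F := fun i : (ℕ → Neg S) × (ℕ → Neg S) => fun P => (P.subst i.1).subst i.2)
    (G := fun i P => P.subst fun k => Neg.subst i.2 (i.1 k))
    (f := fun i N => Neg.subst i.2 (Neg.subst i.1 N))
    (g := fun i => Neg.subst fun k => Neg.subst i.2 (i.1 k)) ?_ ?_ ?_ (σ, τ) P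
  · intro i P
    simp only [Pos.dest_subst, PosF.mapNeg_mapNeg]
  · intro i P
    rw [Pos.dest_subst]
  · rintro ⟨σ, τ⟩ (k | Q)
    · exact .refl (fun _ => .inl rfl) _
    · refine .sum fun a => .inr ⟨(liftSubst (S.arity a) σ, liftSubst (S.arity a) τ), Q a, rfl, ?_⟩
      exact congrArg (Pos.subst · (Q a)) (funext fun k => (subst_liftSubst _ σ τ k).symm)

theorem liftSubst_var (m : ℕ) : liftSubst m (NegF.var : ℕ → Neg S) = NegF.var := by
  funext k
  unfold liftSubst
  split_ifs with h
  · rfl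
  · exact congrArg NegF.var (Nat.sub_add_cancel (Nat.le_of_not_lt h))

theorem Pos.subst_var (P : Pos S) : P.subst .var = P := by
  refine Pos.family_eq (ι := Unit) (F := fun _ P => P.subst .var) (G := fun _ P => P)
    (f := fun _ => Neg.subst .var) (g := fun _ N => N) ?_ ?_ ?_ () P
  · intro i P
    exact Pos.dest_subst _ P
  · intro i P
    cases P.dest <;> rfl
  · rintro - (k | Q)
    · exact .var k
    · refine .sum fun a => .inr ⟨(), Q a, ?_, rfl⟩
      exact congrArg (Pos.subst · (Q a)) (liftSubst_var _)

theorem Neg.subst_var (N : Neg S) : Neg.subst .var N = N := by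
  cases N with
  | var k => rfl
  | sum Q =>
    refine congrArg NegF.sum (funext fun a => ?_)
    rw [liftSubst_var, Pos.subst_var]

theorem Pos.rename_eq_subst (ρ : ℕ → ℕ) (P : Pos S) : P.rename ρ = P.subst fun k => .var (ρ k) := by
  rw [← Pos.subst_rename ρ .var P, Pos.subst_var]

/-! ### Reduction -/

theorem Red.subst {P P' : Pos S} (h : Red P P') (σ : ℕ → Neg S) :
    Red (P.subst σ) (P'.subst σ) := by
  obtain @⟨a, Q, N, hP⟩ := h
  have h1 : (P.subst σ).dest = .act a (.sum fun b => (Q b).subst (liftSubst (S.arity b) σ))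
      fun i => Neg.subst σ (N i) := by
    rw [Pos.dest_subst, hP]; rfl
  have h2 := Red.beta h1
  rw [Pos.subst_subst] at h2 ⊢
  convert h2 using 2
  funext k
  -- Below the arity both sides are the substituted argument. Above it, `bindArgs` undoes the shift
  -- that `liftSubst` performed.
  unfold bindArgs liftSubst
  split_ifs with hk
  · simp [Neg.subst, hk]
  · rw [Neg.subst_rename]
    simp only [Neg.subst, Nat.not_lt_of_le (Nat.le_add_left _ _), dite_false, Nat.add_sub_cancel]
    exact (Neg.subst_var _).symm

theorem Red.subst_star {P P' : Pos S} (h : ReflTransGen Red P P') (σ : ℕ → Neg S) :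
    ReflTransGen Red (P.subst σ) (P'.subst σ) :=
  h.lift _ fun _ _ h => h.subst σ

theorem Red.unique {P P₁ P₂ : Pos S} (h₁ : Red P P₁) (h₂ : Red P P₂) : P₁ = P₂ := by
  obtain @⟨a, Q, N, h₁⟩ := h₁
  obtain @⟨a', Q', N', h₂⟩ := h₂
  have e := h₁.symm.trans h₂
  cases e
  rfl

theorem Red.right_unique : Relator.RightUnique (Red (S := S)) := fun _ _ _ => Red.unique

theorem Red.isCut {P P' : Pos S} (h : Red P P') : P.IsCut := by
  obtain ⟨h⟩ := h
  exact ⟨_, _, _, h⟩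

theorem Pos.IsCut.exists_red {P : Pos S} (h : P.IsCut) : ∃ P', Red P P' := by
  obtain ⟨a, Q, N, h⟩ := h
  exact ⟨_, .beta h⟩

theorem eq_of_star_of_not_isCut {P P' : Pos S} (h : ReflTransGen Red P P') (hP : ¬ P.IsCut) :
    P = P' := by
  rcases h.cases_head with h | ⟨c, hc, -⟩
  · exact h
  · exact absurd hc.isCut hP

/-- This makes the choice in `nfStep` harmless: any evaluation of `P` computes the outer layer of
`P.nf`. -/
theorem Evaluates.unique {P R R' : Pos S} (h : Evaluates P R) (h' : Evaluates P R') : R = R' := by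
  rcases ReflTransGen.total_of_right_unique Red.right_unique h.1 h'.1 with h1 | h1
  · exact eq_of_star_of_not_isCut h1 h.2.1
  · exact (eq_of_star_of_not_isCut h1 h'.2.1).symm

theorem Pos.dest_nf_of_evaluates {P R : Pos S} (h : Evaluates P R) :
    P.nf.dest = R.dest.mapNeg Neg.nf := by
  have h' : ∃ R, Evaluates P R := ⟨R, h⟩
  rw [Pos.nf, Pos.dest_corec, nfStep, dif_pos h', h'.choose_spec.unique h, PosF.map_eq_mapNeg]
  rfl

theorem Pos.dest_nf_of_not_evaluates {P : Pos S} (h : ¬ ∃ R, Evaluates P R) :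
    P.nf.dest = .omega := by
  rw [Pos.nf, Pos.dest_corec, nfStep, dif_neg h]
  rfl

/-- Inversion for normal forms: facts about the node of a normal form are traced back to a reduct of
the original design. -/
theorem Pos.exists_evaluates_of_dest_nf_eq_act {P : Pos S} {a : S.Name} {h : Neg S}
    {N : Fin (S.arity a) → Neg S} (e : P.nf.dest = .act a h N) :
    ∃ R h' N', ReflTransGen Red P R ∧ ¬ R.IsCut ∧ R.dest = .act a h' N' ∧ h = Neg.nf h' ∧
      N = fun i => Neg.nf (N' i) := by
  by_cases hP : ∃ R, Evaluates P R
  · obtain ⟨R, hR⟩ := hP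
    rw [Pos.dest_nf_of_evaluates hR] at e
    obtain ⟨h', N', e1, e2, e3⟩ := PosF.mapNeg_eq_act e
    exact ⟨R, h', N', hR.1, hR.2.1, e1, e2, e3⟩
  · rw [Pos.dest_nf_of_not_evaluates hP] at e
    cases e

/-- `P` reduces to the daimon. -/
def Pos.ReachesDaimon (P : Pos S) : Prop := ∃ R, ReflTransGen Red P R ∧ R.dest = .daimon

theorem Pos.not_isCut_of_dest_eq_daimon {P : Pos S} (h : P.dest = .daimon) : ¬ P.IsCut := by
  rintro ⟨a, Q, N, h'⟩
  cases h.symm.trans h'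

theorem Pos.ReachesDaimon.exists_evaluates {P : Pos S} (h : P.ReachesDaimon) :
    ∃ R, Evaluates P R ∧ R.dest = .daimon := by
  obtain ⟨R, h1, h2⟩ := h
  exact ⟨R, ⟨h1, Pos.not_isCut_of_dest_eq_daimon h2, by simp [h2]⟩, h2⟩

/-- Orthogonality becomes reachability along a finite reduction, which is open to induction. -/
theorem Pos.dest_nf_eq_daimon_iff {P : Pos S} : P.nf.dest = .daimon ↔ P.ReachesDaimon := by
  constructor
  · intro h
    by_cases hP : ∃ R, Evaluates P R
    · obtain ⟨R, hR⟩ := hP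
      rw [Pos.dest_nf_of_evaluates hR] at h
      refine ⟨R, hR.1, ?_⟩
      cases hd : R.dest <;> simp [hd, PosF.mapNeg] at h ⊢
    · rw [Pos.dest_nf_of_not_evaluates hP] at h
      cases h
  · intro h
    obtain ⟨R, hR, hd⟩ := h.exists_evaluates
    rw [Pos.dest_nf_of_evaluates hR, hd]
    rfl

/-- A divergent design never exposes a variable in head position, so a substitution has nothing to
activate. -/
theorem not_evaluates_subst {P : Pos S} (hP : ¬ ∃ R, Evaluates P R) (σ : ℕ → Neg S) :
    ¬ ∃ R, Evaluates (P.subst σ) R := by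
  have key {Q : Pos S} (h : ReflTransGen Red P Q) : Q.IsCut ∨ Q.dest = .omega := by
    by_contra! hQ
    exact hP ⟨Q, h, hQ⟩
  have omega_subst {Q : Pos S} (h : Q.dest = .omega) : (Q.subst σ).dest = .omega := by
    rw [Pos.dest_subst, h]; rfl
  rintro ⟨R, h1, h2, h3⟩
  -- Reduction is deterministic and commutes with `σ`, so every reduct of `P.subst σ` is the image
  -- of a reduct of `P`.
  have : ∃ Q, ReflTransGen Red P Q ∧ R = Q.subst σ := by
    clear h2 h3
    induction h1 with
    | refl => exact ⟨P, .refl, rfl⟩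
    | tail _ hr ih =>
      obtain ⟨Q, hQ, rfl⟩ := ih
      rcases key hQ with hc | ho
      · obtain ⟨Q', hQ'⟩ := hc.exists_red
        exact ⟨Q', hQ.tail hQ', hr.unique (hQ'.subst σ)⟩
      · obtain ⟨a, Q', N, e⟩ := hr.isCut
        cases (omega_subst ho).symm.trans e
  obtain ⟨Q, hQ, rfl⟩ := this
  rcases key hQ with hc | ho
  · obtain ⟨Q', hQ'⟩ := hc.exists_red
    exact h2 (hQ'.subst σ).isCut
  · exact h3 (omega_subst ho)

/-! ### Normalization commutes with substitution, up to convergence to the daimon -/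

/-- The least relation containing equality and normalization and closed under substitution. -/
inductive NfRel : Pos S → Pos S → Prop
  | refl (P : Pos S) : NfRel P P
  | nf (P : Pos S) : NfRel P P.nf
  | subst {P P' : Pos S} {σ σ' : ℕ → Neg S} (hP : NfRel P P')
      (hv : ∀ k j, σ k = .var j ↔ σ' k = .var j)
      (hs : ∀ k Q Q', σ k = .sum Q → σ' k = .sum Q' → ∀ a, NfRel (Q a) (Q' a)) :
      NfRel (P.subst σ) (P'.subst σ')

/-- The usable form of the constructor `NfRel.subst`, which spells out `NegF.Rel NfRel` so that
`NfRel` is not a nested inductive predicate. -/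
theorem NfRel.subst_of_rel {P P' : Pos S} {σ σ' : ℕ → Neg S} (hP : NfRel P P')
    (h : ∀ k, (σ k).Rel NfRel (σ' k)) : NfRel (P.subst σ) (P'.subst σ') := by
  refine .subst hP (fun k j => ?_) fun k Q Q' e e' => ?_
  · have := h k
    generalize σ k = N, σ' k = N' at this
    cases this <;> simp
  · have := h k
    rw [e, e'] at this
    cases this with
    | sum h => exact h

theorem NfRel.neg_rename {N N' : Neg S} (h : N.Rel NfRel N') (ρ : ℕ → ℕ) :
    (Neg.rename ρ N).Rel NfRel (Neg.rename ρ N') := by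
  cases h with
  | var k => exact .var _
  | sum h =>
    refine .sum fun a => ?_
    change NfRel (Pos.rename _ _) (Pos.rename _ _)
    rw [Pos.rename_eq_subst, Pos.rename_eq_subst]
    exact (h a).subst_of_rel fun k => .var _

theorem NfRel.neg_subst {N N' : Neg S} (h : N.Rel NfRel N') {σ σ' : ℕ → Neg S}
    (hσ : ∀ k, (σ k).Rel NfRel (σ' k)) : (Neg.subst σ N).Rel NfRel (Neg.subst σ' N') := by
  cases h with
  | var k => exact hσ k
  | sum h =>
    refine .sum fun a => (h a).subst_of_rel fun k => ?_
    unfold liftSubst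
    split_ifs
    · exact .var _
    · exact NfRel.neg_rename (hσ _) _

theorem NfRel.neg_nf (N : Neg S) : N.Rel NfRel (Neg.nf N) := by
  cases N with
  | var k => exact .var k
  | sum Q => exact .sum fun a => .nf (Q a)

/-- The right-hand design is already normalized in places, so only `P` has to move to expose a
matching layer. The first alternative covers an `Ω` that normalization put in place of a divergent
design; it survives substitution by `not_evaluates_subst`. -/
theorem NfRel.simulates {P P' : Pos S} (h : NfRel P P') :
    ((¬ ∃ R, Evaluates P R) ∧ P'.dest = .omega) ∨
      ∃ Q, ReflTransGen Red P Q ∧ PosF.Rel NfRel Q.dest P'.dest := by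
  induction h with
  | refl P => exact .inr ⟨P, .refl, .refl NfRel.refl _⟩
  | nf P =>
    by_cases hP : ∃ R, Evaluates P R
    · obtain ⟨R, hR⟩ := hP
      refine .inr ⟨R, hR.1, ?_⟩
      rw [Pos.dest_nf_of_evaluates hR]
      cases R.dest with
      | omega => exact .omega
      | daimon => exact .daimon
      | act a h N => exact .act (NfRel.neg_nf h) fun i => NfRel.neg_nf (N i)
    · exact .inl ⟨hP, Pos.dest_nf_of_not_evaluates hP⟩
  | @subst P P' σ σ' hP hv hs ih =>
    have hσ (k : ℕ) : (σ k).Rel NfRel (σ' k) := by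
      have h1 := hv k
      have h2 := hs k
      generalize σ k = N, σ' k = N' at h1 h2
      cases N with
      | var j => rw [(h1 j).1 rfl]; exact .var j
      | sum Q =>
        cases N' with
        | var j => cases (h1 j).2 rfl
        | sum Q' => exact .sum (h2 Q Q' rfl rfl)
    rcases ih with ⟨h1, h2⟩ | ⟨Q, h1, h2⟩
    · refine .inl ⟨not_evaluates_subst h1 σ, ?_⟩
      rw [Pos.dest_subst, h2]
      rfl
    · refine .inr ⟨_, Red.subst_star h1 σ, ?_⟩
      rw [Pos.dest_subst, Pos.dest_subst]
      generalize Q.dest = x, P'.dest = y at h2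
      cases h2 with
      | omega => exact .omega
      | daimon => exact .daimon
      | act hh hN => exact .act (NfRel.neg_subst hh hσ) fun i => NfRel.neg_subst (hN i) hσ

/-- Matching cuts fire in lockstep, and closure of `NfRel` under substitution relates their
contracta. -/
theorem NfRel.red {P P' : Pos S} (h : PosF.Rel NfRel P.dest P'.dest) {P₁ : Pos S} (hP : Red P P₁) :
    ∃ P₁', Red P' P₁' ∧ NfRel P₁ P₁' := by
  obtain @⟨a, Q, N, hP⟩ := hP
  rw [hP] at h
  generalize hy : P'.dest = y at h
  cases h with
  | act hh hN =>
    cases hh with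
    | sum hQ =>
      refine ⟨_, .beta hy, (hQ a).subst_of_rel fun k => ?_⟩
      unfold bindArgs
      split_ifs
      · exact hN _
      · exact .var _

theorem PosF.Rel.isCut {r : Pos S → Pos S → Prop} {P P' : Pos S}
    (h : PosF.Rel r P.dest P'.dest) (h' : P'.IsCut) : P.IsCut := by
  obtain ⟨a, Q, N, e⟩ := h'
  rw [e] at h
  generalize hx : P.dest = x at h
  cases h with
  | act hh hN =>
    cases hh with
    | sum hQ => exact ⟨_, _, _, hx⟩

theorem NfRel.reachesDaimon_right {P P' : Pos S} (h : NfRel P P') (hP : P.ReachesDaimon) :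
    P'.ReachesDaimon := by
  obtain ⟨R, hR, hd⟩ := hP
  have ev {P : Pos S} (h : ReflTransGen Red P R) : ∃ R, Evaluates P R :=
    let ⟨R, h, _⟩ := Pos.ReachesDaimon.exists_evaluates ⟨R, h, hd⟩
    ⟨R, h⟩
  -- The induction follows the reduction of `P`, so the claim is strengthened: `P'` may match a
  -- later reduct of `P` rather than `P` itself.
  have key : ∀ P' : Pos S, (∃ Q, ReflTransGen Red P Q ∧ PosF.Rel NfRel Q.dest P'.dest) →
      P'.ReachesDaimon := by
    clear h
    induction hR using ReflTransGen.head_induction_on with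
    | refl =>
      rintro P' ⟨Q, hQ, hr⟩
      rw [← eq_of_star_of_not_isCut hQ (Pos.not_isCut_of_dest_eq_daimon hd), hd] at hr
      generalize hy : P'.dest = y at hr
      cases hr
      exact ⟨P', .refl, hy⟩
    | @head P P₁ h1 h2 ih =>
      rintro P' ⟨Q, hQ, hr⟩
      -- If `P` already matches `P'`, both take a step and a new match is sought. Otherwise the step
      -- of `P` only brings it closer to `Q`, and `P'` waits.
      rcases hQ.cases_head with rfl | ⟨P₂, h3, h4⟩
      · obtain ⟨P₁', h5, h6⟩ := NfRel.red hr h1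
        rcases h6.simulates with ⟨h7, -⟩ | h7
        · exact absurd (ev h2) h7
        · obtain ⟨D, h8, h9⟩ := ih P₁' h7
          exact ⟨D, .head h5 h8, h9⟩
      · cases h1.unique h3
        exact ih P' ⟨Q, h4, hr⟩
  rcases h.simulates with ⟨h1, -⟩ | h1
  · exact absurd (ev hR) h1
  · exact key P' h1

theorem NfRel.reachesDaimon_left {P P' : Pos S} (h : NfRel P P') (hP' : P'.ReachesDaimon) :
    P.ReachesDaimon := by
  obtain ⟨R, hR, hd⟩ := hP'
  induction hR using ReflTransGen.head_induction_on generalizing P with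
  | refl =>
    rcases h.simulates with ⟨-, h1⟩ | ⟨Q, hQ, hr⟩
    · cases h1.symm.trans hd
    · rw [hd] at hr
      generalize hx : Q.dest = x at hr
      cases hr
      exact ⟨Q, hQ, hx⟩
  | @head P' P₁' h1 h2 ih =>
    rcases h.simulates with ⟨-, h3⟩ | ⟨Q, hQ, hr⟩
    · obtain ⟨a, Q, N, h4⟩ := h1.isCut
      cases h3.symm.trans h4
    · obtain ⟨Q₁, hQ₁⟩ := (hr.isCut h1.isCut).exists_red
      obtain ⟨P₂', h3, h4⟩ := NfRel.red hr hQ₁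
      cases h1.unique h3
      obtain ⟨D, h5, h6⟩ := ih h4
      exact ⟨D, hQ.trans (.head hQ₁ h5), h6⟩

theorem NfRel.reachesDaimon_iff {P P' : Pos S} (h : NfRel P P') :
    P.ReachesDaimon ↔ P'.ReachesDaimon :=
  ⟨h.reachesDaimon_right, h.reachesDaimon_left⟩

theorem dest_nf_subst_nf_eq_daimon_iff (P : Pos S) (σ : ℕ → Neg S) :
    (P.nf.subst σ).nf.dest = .daimon ↔ (P.subst σ).nf.dest = .daimon := by
  rw [Pos.dest_nf_eq_daimon_iff, Pos.dest_nf_eq_daimon_iff]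
  exact ((NfRel.nf P).subst_of_rel fun k => .refl .refl _).reachesDaimon_iff.symm

theorem dest_nf_subst_single_nf_eq_daimon_iff (P : Pos S) (N : Neg S) :
    (P.subst (single (Neg.nf N))).nf.dest = .daimon ↔ (P.subst (single N)).nf.dest = .daimon := by
  rw [Pos.dest_nf_eq_daimon_iff, Pos.dest_nf_eq_daimon_iff]
  refine ((NfRel.refl P).subst_of_rel fun k => ?_).reachesDaimon_iff.symm
  unfold single
  split_ifs
  · exact NfRel.neg_nf N
  · exact .refl .refl _

/-! ### Free variables -/

theorem Pos.Free.of_comp {k : ℕ} {P : Pos S} {a : S.Name} {h : Neg S}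
    {N : Fin (S.arity a) → Neg S} (hP : P.dest = .act a h N) (o : Option (Fin (S.arity a)))
    (hk : Neg.Free k (comp h N o)) : P.Free k := by
  generalize hc : comp h N o = M at hk
  cases M with
  | var j => cases hk; exact .var o hP hc
  | sum Q =>
    obtain ⟨b, hb⟩ := hk
    exact .sum o b hP hc hb

theorem Pos.Free.exists_of_rename {k : ℕ} {P : Pos S} {ρ : ℕ → ℕ} (hk : (P.rename ρ).Free k) :
    ∃ j, P.Free j ∧ ρ j = k := by
  generalize hX : P.rename ρ = X at hk
  induction hk generalizing P ρ with
  | var o h1 h2 =>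
    subst hX
    rw [Pos.dest_rename] at h1
    obtain ⟨h', N', e1, rfl, rfl⟩ := PosF.mapNeg_eq_act h1
    rw [comp_map] at h2
    cases hc : comp h' N' o with
    | sum Q => rw [hc] at h2; cases h2
    | var j => rw [hc] at h2; cases h2; exact ⟨j, .var o e1 hc, rfl⟩
  | @sum k X a h N Q o b h1 h2 h3 ih =>
    subst hX
    rw [Pos.dest_rename] at h1
    obtain ⟨h', N', e1, rfl, rfl⟩ := PosF.mapNeg_eq_act h1
    rw [comp_map] at h2
    cases hc : comp h' N' o with
    | var j => rw [hc] at h2; cases h2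
    | sum Q' =>
      rw [hc] at h2
      cases h2
      obtain ⟨j, hj, e⟩ := ih rfl
      change liftRen (S.arity b) ρ j = _ at e
      unfold liftRen at e
      split_ifs at e with hlt
      -- `liftRen` fixes a bound index, which lies below `S.arity b` and so cannot equal `k +
      -- S.arity b`.
      · omega
      · refine ⟨j - S.arity b, .sum o b e1 hc ?_, by omega⟩
        rwa [Nat.sub_add_cancel (Nat.le_of_not_lt hlt)]

theorem Neg.Free.exists_of_rename {k : ℕ} {N : Neg S} {ρ : ℕ → ℕ}
    (hk : Neg.Free k (Neg.rename ρ N)) : ∃ j, Neg.Free j N ∧ ρ j = k := by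
  cases N with
  | var j => exact ⟨j, rfl, hk⟩
  | sum Q =>
    obtain ⟨b, hb⟩ := hk
    obtain ⟨j, hj, e⟩ := Pos.Free.exists_of_rename hb
    change liftRen (S.arity b) ρ j = _ at e
    unfold liftRen at e
    split_ifs at e with hlt
    · omega
    · refine ⟨j - S.arity b, ⟨b, ?_⟩, by omega⟩
      rwa [Nat.sub_add_cancel (Nat.le_of_not_lt hlt)]

theorem free_liftSubst {m k j : ℕ} {σ : ℕ → Neg S} (h : Neg.Free k (liftSubst m σ j)) :
    (j < m ∧ j = k) ∨ (m ≤ j ∧ m ≤ k ∧ Neg.Free (k - m) (σ (j - m))) := by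
  unfold liftSubst at h
  split_ifs at h with hlt
  · exact .inl ⟨hlt, h⟩
  · obtain ⟨i, hi, rfl⟩ := h.exists_of_rename
    refine .inr ⟨Nat.le_of_not_lt hlt, Nat.le_add_left _ _, ?_⟩
    simpa using hi

theorem Pos.Free.exists_of_subst {k : ℕ} {P : Pos S} {σ : ℕ → Neg S}
    (hk : (P.subst σ).Free k) : ∃ j, P.Free j ∧ Neg.Free k (σ j) := by
  generalize hX : P.subst σ = X at hk
  induction hk generalizing P σ with
  | var o h1 h2 =>
    subst hX
    rw [Pos.dest_subst] at h1
    obtain ⟨h', N', e1, rfl, rfl⟩ := PosF.mapNeg_eq_act h1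
    rw [comp_map] at h2
    cases hc : comp h' N' o with
    | sum Q => rw [hc] at h2; cases h2
    | var j =>
      rw [hc] at h2
      refine ⟨j, .var o e1 hc, ?_⟩
      change σ j = _ at h2
      rw [h2]
      rfl
  | @sum k X a h N Q o b h1 h2 h3 ih =>
    subst hX
    rw [Pos.dest_subst] at h1
    obtain ⟨h', N', e1, rfl, rfl⟩ := PosF.mapNeg_eq_act h1
    rw [comp_map] at h2
    cases hc : comp h' N' o with
    | var j =>
      rw [hc] at h2
      refine ⟨j, .var o e1 hc, ?_⟩
      change σ j = _ at h2
      rw [h2]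
      exact ⟨b, h3⟩
    | sum Q' =>
      rw [hc] at h2
      cases h2
      obtain ⟨j, hj, e⟩ := ih rfl
      rcases free_liftSubst e with ⟨h4, h5⟩ | ⟨h4, -, h5⟩
      · omega
      · refine ⟨j - S.arity b, .sum o b e1 hc ?_, by simpa using h5⟩
        rwa [Nat.sub_add_cancel h4]

theorem Neg.Free.exists_of_subst {k : ℕ} {N : Neg S} {σ : ℕ → Neg S}
    (hk : Neg.Free k (Neg.subst σ N)) : ∃ j, Neg.Free j N ∧ Neg.Free k (σ j) := by
  cases N with
  | var j => exact ⟨j, rfl, hk⟩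
  | sum Q =>
    obtain ⟨b, hb⟩ := hk
    obtain ⟨j, hj, e⟩ := Pos.Free.exists_of_subst hb
    rcases free_liftSubst e with ⟨h4, h5⟩ | ⟨h4, -, h5⟩
    · omega
    · refine ⟨j - S.arity b, ⟨b, ?_⟩, by simpa using h5⟩
      rwa [Nat.sub_add_cancel h4]

theorem Red.free {P P' : Pos S} (h : Red P P') {k : ℕ} (hk : P'.Free k) : P.Free k := by
  obtain @⟨a, Q, N, hP⟩ := h
  obtain ⟨j, hj, hk⟩ := hk.exists_of_subst
  unfold bindArgs at hk
  split_ifs at hk with hlt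
  · exact .of_comp hP (some ⟨j, hlt⟩) hk
  · refine .of_comp hP none ⟨a, ?_⟩
    cases hk
    rwa [Nat.sub_add_cancel (Nat.le_of_not_lt hlt)]

theorem Red.free_star {P P' : Pos S} (h : ReflTransGen Red P P') {k : ℕ} (hk : P'.Free k) :
    P.Free k := by
  induction h with
  | refl => exact hk
  | tail _ h ih => exact ih (h.free hk)

theorem Pos.Free.of_nf {k : ℕ} {P : Pos S} (hk : P.nf.Free k) : P.Free k := by
  generalize hX : P.nf = X at hk
  induction hk generalizing P with
  | var o h1 h2 =>
    subst hX
    obtain ⟨R, h', N', hR, -, e1, rfl, rfl⟩ := Pos.exists_evaluates_of_dest_nf_eq_act h1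
    refine Red.free_star hR (.of_comp e1 o ?_)
    rw [comp_map] at h2
    cases hc : comp h' N' o with
    | sum Q => rw [hc] at h2; cases h2
    | var j => rw [hc] at h2; cases h2; rfl
  | sum o b h1 h2 h3 ih =>
    subst hX
    obtain ⟨R, h', N', hR, -, e1, rfl, rfl⟩ := Pos.exists_evaluates_of_dest_nf_eq_act h1
    refine Red.free_star hR (.of_comp e1 o ?_)
    rw [comp_map] at h2
    cases hc : comp h' N' o with
    | var j => rw [hc] at h2; cases h2
    | sum Q' => rw [hc] at h2; cases h2; exact ⟨b, ih rfl⟩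

theorem Neg.Free.of_nf {k : ℕ} {N : Neg S} (hk : Neg.Free k (Neg.nf N)) : Neg.Free k N := by
  cases N with
  | var j => exact hk
  | sum Q =>
    obtain ⟨b, hb⟩ := hk
    exact ⟨b, hb.of_nf⟩

/-! ### Cut-freeness of normal forms -/

/-- Every node of a normal form is the root of another normal form, so cut-freeness only has to be
checked at roots. -/
theorem Subdesign.exists_eq_nf {R P : Pos S} (h : Subdesign R P.nf) :
    ∃ P' : Pos S, R = P'.nf := by
  generalize hX : P.nf = X at h
  induction h generalizing P with
  | refl => exact ⟨P, hX.symm⟩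
  | step o b h1 h2 h3 ih =>
    subst hX
    obtain ⟨R, h', N', -, -, -, rfl, rfl⟩ := Pos.exists_evaluates_of_dest_nf_eq_act h1
    rw [comp_map] at h2
    cases hc : comp h' N' o with
    | var j => rw [hc] at h2; cases h2
    | sum Q' => rw [hc] at h2; cases h2; exact ih rfl

theorem Pos.cutFree_nf (P : Pos S) : P.nf.CutFree := by
  rintro R hR ⟨a, Q, N, e⟩
  obtain ⟨P, rfl⟩ := hR.exists_eq_nf
  obtain ⟨R, h', N', -, hR', e1, e2, -⟩ := Pos.exists_evaluates_of_dest_nf_eq_act e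
  cases h' with
  | var j => cases e2
  | sum Q' => exact hR' ⟨_, _, _, e1⟩

theorem Neg.cutFree_nf (N : Neg S) : Neg.CutFree (Neg.nf N) := by
  cases N with
  | var j => trivial
  | sum Q => exact fun b => Pos.cutFree_nf (Q b)

/-! ### Linearity -/

/-- The linearity condition at the root. -/
def Pos.RootLinear (P : Pos S) : Prop :=
  ∀ a h N, P.dest = .act a h N →
    ∀ i j, i ≠ j → ∀ k, ¬ (Neg.Free k (comp h N i) ∧ Neg.Free k (comp h N j))

theorem Pos.Linear.rootLinear {P : Pos S} (h : P.Linear) : P.RootLinear := h P (.refl P)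

theorem Pos.Linear.comp {P : Pos S} (hl : P.Linear) {a : S.Name} {h : Neg S}
    {N : Fin (S.arity a) → Neg S} (hP : P.dest = .act a h N) (o : Option (Fin (S.arity a))) :
    Neg.Linear (comp h N o) := by
  cases hc : Ludics.comp h N o with
  | var k => trivial
  | sum Q => exact fun b R hR => hl R (.step o b hP hc hR)

theorem Neg.Linear.of_comp_eq_sum {M : Neg S} (h : Neg.Linear M) {Q : S.Name → Pos S}
    (e : M = .sum Q) (b : S.Name) : (Q b).Linear := by
  subst e
  exact h b

/-- Linearity by coinduction. -/
theorem Pos.linear_of_invariant (I : Pos S → Prop) (hroot : ∀ P, I P → P.RootLinear)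
    (hstep : ∀ P, I P → ∀ a h N, P.dest = .act a h N → ∀ o Q, comp h N o = .sum Q →
      ∀ b, I (Q b)) {P : Pos S} (hP : I P) : P.Linear := by
  intro R hR
  induction hR with
  | refl => exact hroot _ hP
  | step o b h1 h2 _ ih => exact ih (hstep _ hP _ _ _ h1 o _ h2 b)

theorem liftRen_injective {m : ℕ} {ρ : ℕ → ℕ} (h : ρ.Injective) : (liftRen m ρ).Injective := by
  intro i j e
  unfold liftRen at e
  split_ifs at e
  · exact e
  · omega
  · omega
  · have := h (Nat.add_right_cancel e)
    omega

theorem Pos.Linear.rename {P : Pos S} (hP : P.Linear) {ρ : ℕ → ℕ} (hρ : ρ.Injective) :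
    (P.rename ρ).Linear := by
  refine Pos.linear_of_invariant
    (fun X => ∃ (P : Pos S) (ρ : ℕ → ℕ), P.Linear ∧ ρ.Injective ∧ X = P.rename ρ) ?_ ?_
    ⟨P, ρ, hP, hρ, rfl⟩
  · rintro _ ⟨P, ρ, hP, hρ, rfl⟩ a h N e i j hij k ⟨h1, h2⟩
    rw [Pos.dest_rename] at e
    obtain ⟨h', N', e1, rfl, rfl⟩ := PosF.mapNeg_eq_act e
    rw [comp_map] at h1 h2
    obtain ⟨l, h3, rfl⟩ := h1.exists_of_rename
    obtain ⟨l', h4, e2⟩ := h2.exists_of_rename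
    cases hρ e2
    exact hP.rootLinear a h' N' e1 i j hij l ⟨h3, h4⟩
  · rintro _ ⟨P, ρ, hP, hρ, rfl⟩ a h N e o Q hQ b
    rw [Pos.dest_rename] at e
    obtain ⟨h', N', e1, rfl, rfl⟩ := PosF.mapNeg_eq_act e
    rw [comp_map] at hQ
    cases hc : Ludics.comp h' N' o with
    | var j => rw [hc] at hQ; cases hQ
    | sum Q' =>
      rw [hc] at hQ
      cases hQ
      exact ⟨_, _, (hP.comp e1 o).of_comp_eq_sum hc b, liftRen_injective hρ, rfl⟩

theorem Neg.Linear.rename {N : Neg S} (hN : Neg.Linear N) {ρ : ℕ → ℕ} (hρ : ρ.Injective) :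
    Neg.Linear (Neg.rename ρ N) := by
  cases N with
  | var k => trivial
  | sum Q => exact fun b => Pos.Linear.rename (hN b) (liftRen_injective hρ)

/-- The substitution `σ` is linear on the variables satisfying `p`. -/
structure LinearSubstOn (p : ℕ → Prop) (σ : ℕ → Neg S) : Prop where
  linear : ∀ j, p j → Neg.Linear (σ j)
  disjoint : ∀ i j, p i → p j → i ≠ j → ∀ k, ¬ (Neg.Free k (σ i) ∧ Neg.Free k (σ j))

theorem LinearSubstOn.mono {p q : ℕ → Prop} {σ : ℕ → Neg S} (h : LinearSubstOn p σ)
    (hq : ∀ j, q j → p j) : LinearSubstOn q σ :=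
  ⟨fun j hj => h.linear j (hq j hj), fun i j hi hj => h.disjoint i j (hq i hi) (hq j hj)⟩

/-- Bound variables stay below `m` while the substituted designs are shifted to `m` and above, so no
new sharing can arise; on bound indices the lifted predicate holds vacuously. -/
theorem LinearSubstOn.lift {p : ℕ → Prop} {σ : ℕ → Neg S} (h : LinearSubstOn p σ) (m : ℕ) :
    LinearSubstOn (fun j => m ≤ j → p (j - m)) (liftSubst m σ) := by
  constructor
  · intro j hj
    unfold liftSubst
    split_ifs with hlt
    · trivial
    · exact (h.linear _ (hj (Nat.le_of_not_lt hlt))).rename (add_left_injective m)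
  · rintro i j hi hj hij k ⟨h1, h2⟩
    rcases free_liftSubst h1 with ⟨h3, h4⟩ | ⟨h3, h4, h5⟩ <;>
      rcases free_liftSubst h2 with ⟨h6, h7⟩ | ⟨h6, h7, h8⟩
    · omega
    · omega
    · omega
    · exact h.disjoint _ _ (hi h3) (hj h6) (by omega) _ ⟨h5, h8⟩

theorem Pos.Linear.subst {P : Pos S} (hP : P.Linear) {σ : ℕ → Neg S}
    (hσ : LinearSubstOn (fun k => P.Free k) σ) : (P.subst σ).Linear := by
  -- A subdesign of `P.subst σ` lies either inside a copied `σ k`, covered by the first disjunct, or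
  -- is itself a substitution instance of a subdesign of `P`.
  refine Pos.linear_of_invariant
    (fun X => X.Linear ∨ ∃ (P : Pos S) (σ : ℕ → Neg S), P.Linear ∧
      LinearSubstOn (fun k => P.Free k) σ ∧ X = P.subst σ) ?_ ?_
    (.inr ⟨P, σ, hP, hσ.mono fun _ h => h, rfl⟩)
  · rintro _ (hX | ⟨P, σ, hP, hσ, rfl⟩)
    · exact hX.rootLinear
    rintro a h N e i j hij k ⟨h1, h2⟩
    rw [Pos.dest_subst] at e
    obtain ⟨h', N', e1, rfl, rfl⟩ := PosF.mapNeg_eq_act e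
    rw [comp_map] at h1 h2
    obtain ⟨l, h3, h5⟩ := h1.exists_of_subst
    obtain ⟨l', h4, h6⟩ := h2.exists_of_subst
    -- A shared variable comes either from one variable occurring in two components of `P`, or from
    -- two variables whose images overlap.
    by_cases hl : l = l'
    · subst hl
      exact hP.rootLinear a h' N' e1 i j hij l ⟨h3, h4⟩
    · exact hσ.disjoint l l' (.of_comp e1 i h3) (.of_comp e1 j h4) hl k ⟨h5, h6⟩
  · rintro _ (hX | ⟨P, σ, hP, hσ, rfl⟩) a h N e o Q hQ b
    · exact .inl ((hX.comp e o).of_comp_eq_sum hQ b)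
    rw [Pos.dest_subst] at e
    obtain ⟨h', N', e1, rfl, rfl⟩ := PosF.mapNeg_eq_act e
    rw [comp_map] at hQ
    cases hc : Ludics.comp h' N' o with
    | var j =>
      rw [hc] at hQ
      exact .inl ((hσ.linear j (.var o e1 hc)).of_comp_eq_sum hQ b)
    | sum Q' =>
      rw [hc] at hQ
      cases hQ
      refine .inr ⟨_, _, (hP.comp e1 o).of_comp_eq_sum hc b, (hσ.lift _).mono ?_, rfl⟩
      intro j hj hle
      refine .sum o b e1 hc ?_
      rwa [Nat.sub_add_cancel hle]

theorem Neg.Linear.subst {N : Neg S} (hN : Neg.Linear N) {σ : ℕ → Neg S}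
    (hσ : LinearSubstOn (fun k => Neg.Free k N) σ) : Neg.Linear (Neg.subst σ N) := by
  cases N with
  | var k => exact hσ.linear k rfl
  | sum Q =>
    intro b
    refine Pos.Linear.subst (hN b) ((hσ.lift _).mono fun j hj hle => ⟨b, ?_⟩)
    rwa [Nat.sub_add_cancel hle]

theorem Red.linear {P P' : Pos S} (h : Red P P') (hP : P.Linear) : P'.Linear := by
  obtain @⟨a, Q, N, e⟩ := h
  have hsum {k : ℕ} (hk : (Q a).Free k) (hle : S.arity a ≤ k) :
      Neg.Free (k - S.arity a) (comp (NegF.sum Q) N none) := by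
    refine ⟨a, ?_⟩
    rwa [Nat.sub_add_cancel hle]
  -- An index beyond the arity names a variable free in the head, hence absent from all arguments;
  -- so `bindArgs N` is linear on the free variables of `Q a`.
  refine Pos.Linear.subst (hP.comp e none a) ⟨fun j hj => ?_, ?_⟩
  · unfold bindArgs
    split_ifs with hlt
    · exact hP.comp e (some ⟨j, hlt⟩)
    · trivial
  · rintro i j hi hj hij k ⟨h1, h2⟩
    unfold bindArgs at h1 h2
    split_ifs at h1 h2 with h3 h4 h4
    · exact hP.rootLinear _ _ _ e (some ⟨i, h3⟩) (some ⟨j, h4⟩) (by simpa using hij) k ⟨h1, h2⟩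
    · cases h2
      exact hP.rootLinear _ _ _ e (some ⟨i, h3⟩) none (by simp) _
        ⟨h1, hsum hj (Nat.le_of_not_lt h4)⟩
    · cases h1
      exact hP.rootLinear _ _ _ e (some ⟨j, h4⟩) none (by simp) _
        ⟨h2, hsum hi (Nat.le_of_not_lt h3)⟩
    · cases h1
      change j - S.arity a = i - S.arity a at h2
      omega

theorem Red.linear_star {P P' : Pos S} (h : ReflTransGen Red P P') (hP : P.Linear) :
    P'.Linear := by
  induction h with
  | refl => exact hP
  | tail _ h ih => exact h.linear ih

theorem Pos.Linear.nf {P : Pos S} (hP : P.Linear) : P.nf.Linear := by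
  refine Pos.linear_of_invariant (fun X => ∃ P : Pos S, P.Linear ∧ X = P.nf) ?_ ?_ ⟨P, hP, rfl⟩
  · rintro _ ⟨P, hP, rfl⟩ a h N e i j hij k ⟨h1, h2⟩
    obtain ⟨R, h', N', hR, -, e1, rfl, rfl⟩ := Pos.exists_evaluates_of_dest_nf_eq_act e
    rw [comp_map] at h1 h2
    exact (Red.linear_star hR hP).rootLinear a h' N' e1 i j hij k ⟨h1.of_nf, h2.of_nf⟩
  · rintro _ ⟨P, hP, rfl⟩ a h N e o Q hQ b
    obtain ⟨R, h', N', hR, -, e1, rfl, rfl⟩ := Pos.exists_evaluates_of_dest_nf_eq_act e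
    rw [comp_map] at hQ
    cases hc : Ludics.comp h' N' o with
    | var j => rw [hc] at hQ; cases hQ
    | sum Q' =>
      rw [hc] at hQ
      cases hQ
      exact ⟨_, ((Red.linear_star hR hP).comp e1 o).of_comp_eq_sum hc b, rfl⟩

theorem Neg.Linear.nf {N : Neg S} (hN : Neg.Linear N) : Neg.Linear (Neg.nf N) := by
  cases N with
  | var k => trivial
  | sum Q => exact fun b => Pos.Linear.nf (hN b)

/-! ### The action of functionals -/

theorem linearSubstOn_single {p : ℕ → Prop} (hp : ∀ k, p k → k = 0) {N : Neg S}
    (hN : Neg.Linear N) : LinearSubstOn p (single N) := by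
  constructor
  · intro j hj
    cases hp j hj
    exact hN
  · intro i j hi hj hij
    exact absurd ((hp i hi).trans (hp j hj).symm) hij

/-- The action `p ↦ ⟦p[g/x₀]⟧` of a functional on atomic positive designs. -/
noncomputable def Functional.actPos (g : Functional S) (p : AtomicPos S) : AtomicPos S := by
  refine ⟨(p.1.subst (single g.1)).nf, ?_, Pos.cutFree_nf _, fun k hk => ?_⟩
  · exact (p.2.1.subst (linearSubstOn_single p.2.2.2 g.2.1)).nf
  · obtain ⟨j, hj, h⟩ := hk.of_nf.exists_of_subst
    cases p.2.2.2 j hj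
    exact g.2.2.2 k h

/-- The action `n ↦ ⟦g[n/x₀]⟧` of a functional on atomic negative designs. -/
noncomputable def Functional.actNeg (g : Functional S) (n : AtomicNeg S) : AtomicNeg S := by
  refine ⟨Neg.nf (Neg.subst (single n.1) g.1), ?_, Neg.cutFree_nf _, fun k hk => ?_⟩
  · exact (g.2.1.subst (linearSubstOn_single g.2.2.2 n.2.1)).nf
  · obtain ⟨j, hj, h⟩ := hk.of_nf.exists_of_subst
    cases g.2.2.2 j hj
    exact n.2.2.2 k h

/-- The variable `x₀` of `M` keeps its index, and every `x₀` left after the first substitution comes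
from a copy of `M`. -/
theorem subst_single_subst_single (P : Pos S) (M N : Neg S) :
    (P.subst (single M)).subst (single N) = P.subst (single (Neg.subst (single N) M)) := by
  rw [Pos.subst_subst]
  congr 1
  funext k
  unfold single
  split_ifs with hk
  · rfl
  · exact if_neg hk

/-- The collection of functionals of ludics given by a set of functionals. -/
noncomputable def functionalCollection (F : Set (Functional S)) :
    FunctionalCollection (ludicsTriad S) F where
  interpPos g := g.1.actPos
  interpNeg g := g.1.actNeg

theorem functionalCollection_regular (F : Set (Functional S)) (g : F) :
    (functionalCollection F).Regular g := by
  intro p n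
  change (((p.1.subst (single g.1.1)).nf).subst (single n.1)).nf.dest = .daimon ↔
    (p.1.subst (single (Neg.nf (Neg.subst (single n.1) g.1.1)))).nf.dest = .daimon
  rw [dest_nf_subst_nf_eq_daimon_iff, dest_nf_subst_single_nf_eq_daimon_iff,
    subst_single_subst_single]

end Ludics

theorem theorem5 (S : Ludics.Signature.{u}) (F : Set (Ludics.Functional S)) :
    IsEntailmentSystem (Ludics.ludicsTriad S).Conseq ∧
    IsEntailmentSystem (Ludics.ludicsTriad S).dual.Conseq ∧
    ∃ H : FunctionalCollection (Ludics.ludicsTriad S) F,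
      (∀ (g : F) (p : Ludics.AtomicPos S),
        (H.interpPos g p).1 = (p.1.subst (Ludics.single g.1.1)).nf) ∧
      (∀ (g : F) (n : Ludics.AtomicNeg S),
        (H.interpNeg g n).1 = Ludics.Neg.nf (Ludics.Neg.subst (Ludics.single n.1) g.1.1)) ∧
      ∀ g : F,
        H.Regular g ∧
        H.Continuous g ∧ H.dual.Continuous g ∧
        H.PreservesConseq g ∧ H.dual.PreservesConseq g ∧
        H.PreservesSpec g ∧ H.dual.PreservesSpec g := by
  refine ⟨Triad.isEntailmentSystem_conseq _, Triad.isEntailmentSystem_conseq _,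
    Ludics.functionalCollection F, fun _ _ => rfl, fun _ _ => rfl, fun g => ?_⟩
  have h := Ludics.functionalCollection_regular F g
  exact ⟨h, h.continuous, h.dual.continuous, h.preservesConseq, h.dual.preservesConseq,
    h.preservesSpec, h.dual.preservesSpec⟩
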